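/- For a set $A \subseteq \{0,1,2,\ldots\}$ let its boundary be $\partial A := \{z \in A : \{z-1,z+1\} \not\subseteq A\}$, and let \[ \mathrm{vol}(A) := \sum_{z \in A} z, \qquad \mathrm{per}(A) := \sum_{z \in \partial A} z \] (empty sums are $0$). Write $A^c := \{0,1,2,\ldots\} \setminus A$. For an integer $n \ge 0$ define \[ P(n) := \min_{A \subseteq \{0,1,\ldots\}} \{\mathrm{per}(A) : \mathrm{vol}(A) = n\}, \qquad Q(n) := \min_{A \subseteq \{0,1,\ldots\}} \{\mathrm{per}(A^c) : \mathrm{vol}(A) = n\}. \] Then for all integers $n \ge 0$, \[ -1 \le Q(n) - P(n) \le 2. \] -/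

import Mathlib

namespace IntegerIsoperimetry

/-- The boundary of a set `A` of nonnegative integers: the elements `z` of `A` such that
`z - 1` and `z + 1` do not both belong to `A`. The predecessor is taken in the integers, so
`0` has no predecessor in `A`, and `0` is a boundary point whenever it is in `A`. -/
def boundary (A : Set ℕ) : Set ℕ :=
  {z | z ∈ A ∧ ¬ ((∃ w ∈ A, w + 1 = z) ∧ z + 1 ∈ A)}

/-- The volume of `A`: the sum of its elements. It is only used for finite `A`. -/
noncomputable def vol (A : Set ℕ) : ℕ := ∑ᶠ z ∈ A, z

/-- The perimeter of `A`: the sum of the elements of its boundary. It is only used for finite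
sets and for complements of finite sets, whose boundaries are finite. -/
noncomputable def per (A : Set ℕ) : ℕ := ∑ᶠ z ∈ boundary A, z

/-- `P n` is the least perimeter of a set of nonnegative integers of volume `n`. The sets with
a (finite) volume are the finite sets. -/
noncomputable def P (n : ℕ) : ℕ := sInf {k | ∃ A : Set ℕ, A.Finite ∧ vol A = n ∧ per A = k}

/-- `Q n` is the least perimeter of the complement (in the nonnegative integers) of a set of
nonnegative integers of volume `n`. -/
noncomputable def Q (n : ℕ) : ℕ := sInf {k | ∃ A : Set ℕ, A.Finite ∧ vol A = n ∧ per Aᶜ = k}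

/-- The boundary of a finite set is finite. -/
theorem boundary_finite {A : Set ℕ} (hA : A.Finite) : (boundary A).Finite :=
  hA.subset fun _ hz => hz.1

/-- The boundary of the complement of a finite set is finite. -/
theorem boundary_compl_finite {A : Set ℕ} (hA : A.Finite) : (boundary Aᶜ).Finite := by
  obtain ⟨m, hm⟩ := hA.bddAbove
  refine (Set.finite_Iic (m + 1)).subset fun z hz => ?_
  by_contra hlt
  have hlt' : m + 1 < z := not_le.mp hlt
  refine hz.2 ⟨⟨z - 1, fun h => ?_, by omega⟩, fun h => ?_⟩
  · have := hm h
    omega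
  · have := hm h
    omega

/-- The volume of a singleton. -/
theorem vol_singleton (n : ℕ) : vol {n} = n := finsum_mem_singleton

/-- The minimum that defines `P n` is attained. -/
theorem P_isLeast (n : ℕ) :
    IsLeast {k | ∃ A : Set ℕ, A.Finite ∧ vol A = n ∧ per A = k} (P n) :=
  ⟨Nat.sInf_mem ⟨_, {n}, Set.finite_singleton n, vol_singleton n, rfl⟩, fun _ h => Nat.sInf_le h⟩

/-- The minimum that defines `Q n` is attained. -/
theorem Q_isLeast (n : ℕ) :
    IsLeast {k | ∃ A : Set ℕ, A.Finite ∧ vol A = n ∧ per Aᶜ = k} (Q n) :=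
  ⟨Nat.sInf_mem ⟨_, {n}, Set.finite_singleton n, vol_singleton n, rfl⟩, fun _ h => Nat.sInf_le h⟩

end IntegerIsoperimetry

namespace IntegerIsoperimetry

open Set

/-! Let `A` be optimal of volume `n`, with maximum `k`, and let `m` be the volume of `{0, …, k} \
A`. Complementing in `{0, …, k}` exchanges the two perimeters: `P n ≥ k + Q m` if `k - 1 ∈ A`
(`add_per_compl_le`), and `Q n ≥ k + 1 + P m` (`add_per_le`). Conversely `Q n ≤ k + 1 + P m` and `P
n ≤ k + Q m` (`Q_le`, `P_le`) if the optimal set of volume `m` fits in `{0, …, k}`. So if `m < n`,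
the bounds `P ≤ Q + 1` and `Q ≤ P + 2` at `m` yield each other at `n`. When `m ≥ n` or the set does
not fit, crude bounds near twice the triangular root of `n` suffice. -/

theorem vol_mono {S T : Set ℕ} (hT : T.Finite) (h : S ⊆ T) : vol S ≤ vol T := by
  unfold vol
  rw [finsum_mem_eq_finite_toFinset_sum _ hT, finsum_mem_eq_finite_toFinset_sum _ (hT.subset h)]
  exact Finset.sum_le_sum_of_subset (by simpa using h)

theorem vol_insert {S : Set ℕ} (hS : S.Finite) {a : ℕ} (ha : a ∉ S) :
    vol (insert a S) = a + vol S :=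
  finsum_mem_insert _ ha hS

theorem vol_insert_le {S : Set ℕ} (hS : S.Finite) (a : ℕ) : vol (insert a S) ≤ a + vol S := by
  by_cases ha : a ∈ S
  · rw [insert_eq_of_mem ha]
    omega
  · exact (vol_insert hS ha).le

theorem add_vol_le {S T : Set ℕ} (hS : S.Finite) {a : ℕ} (ha : a ∈ S) (hT : T ⊆ S)
    (haT : a ∉ T) : a + vol T ≤ vol S := by
  rw [← vol_insert (hS.subset hT) haT]
  exact vol_mono hS (insert_subset ha hT)

theorem le_vol {S : Set ℕ} (hS : S.Finite) {a : ℕ} (ha : a ∈ S) : a ≤ vol S := by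
  have := add_vol_le hS ha (empty_subset S) (notMem_empty a)
  omega

theorem vol_empty : vol ∅ = 0 := finsum_mem_empty

theorem two_mul_vol_Iic (k : ℕ) : 2 * vol (Iic k) = k * (k + 1) := by
  have h : vol (Iic k) = ∑ z ∈ Finset.range (k + 1), z := by
    unfold vol
    rw [← finsum_mem_coe_finset]
    congr! 3 with z
    simp
  rw [h, mul_comm, Finset.sum_range_id_mul_two, Nat.add_sub_cancel, mul_comm]

theorem two_mul_vol_le {A : Set ℕ} {k : ℕ} (h : A ⊆ Iic k) : 2 * vol A ≤ k * (k + 1) := by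
  rw [← two_mul_vol_Iic]
  exact Nat.mul_le_mul_left _ (vol_mono (finite_Iic k) h)

theorem two_mul_vol_diff {A : Set ℕ} {k : ℕ} (h : A ⊆ Iic k) :
    2 * vol (Iic k \ A) + 2 * vol A = k * (k + 1) := by
  rw [← two_mul_vol_Iic, ← mul_add, vol, vol, vol, add_comm,
    finsum_mem_add_sdiff h (finite_Iic k)]

theorem exists_max {A : Set ℕ} (hA : A.Finite) (h : vol A ≠ 0) : ∃ k ∈ A, A ⊆ Iic k := by
  have hne : A.Nonempty := by
    rw [nonempty_iff_ne_empty]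
    rintro rfl
    exact h vol_empty
  obtain ⟨k, hk, hmax⟩ := exists_max_image A id hA hne
  exact ⟨k, hk, fun z hz => hmax z hz⟩

theorem max_mem_boundary {A : Set ℕ} {k : ℕ} (hk : k ∈ A) (h : A ⊆ Iic k) :
    k ∈ boundary A := by
  refine ⟨hk, fun hb => ?_⟩
  have := mem_Iic.mp (h hb.2)
  omega

theorem le_per {A : Set ℕ} (hA : A.Finite) {k : ℕ} (hk : k ∈ A) : k ≤ per A := by
  obtain ⟨m, hm, hmax⟩ := exists_max_image A id hA ⟨k, hk⟩
  exact (hmax k hk).trans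
    (le_vol (boundary_finite hA) (max_mem_boundary hm fun z hz => hmax z hz))

theorem lt_per_compl {A : Set ℕ} (hA : A.Finite) {k : ℕ} (hk : k ∈ A) : k < per Aᶜ := by
  obtain ⟨m, hm, hmax⟩ := exists_max_image A id hA ⟨k, hk⟩
  refine (Nat.lt_succ_of_le (hmax k hk)).trans_le (le_vol (boundary_compl_finite hA) ⟨?_, ?_⟩)
  · intro h
    have := hmax _ h
    simp at this
  · rintro ⟨⟨w, hw, e⟩, -⟩
    obtain rfl : w = m := by simpa using e
    exact hw hm

theorem le_P {n m : ℕ} (hn : n ≠ 0) (h : ∀ k, 2 * n ≤ k * (k + 1) → m ≤ k) : m ≤ P n := by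
  obtain ⟨A, hA, rfl, hP⟩ := (P_isLeast n).1
  obtain ⟨k, hk, hmax⟩ := exists_max hA hn
  rw [← hP]
  exact (h k (two_mul_vol_le hmax)).trans (le_per hA hk)

theorem lt_Q {n m : ℕ} (hn : n ≠ 0) (h : ∀ k, 2 * n ≤ k * (k + 1) → m ≤ k) : m < Q n := by
  obtain ⟨A, hA, rfl, hQ⟩ := (Q_isLeast n).1
  obtain ⟨k, hk, hmax⟩ := exists_max hA hn
  rw [← hQ]
  exact (h k (two_mul_vol_le hmax)).trans_lt (lt_per_compl hA hk)

/-- Removing from `{0, …, k}` a set `A` gives an upper bound for `P`. -/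
theorem P_le {n k : ℕ} {A : Set ℕ} (hA : A ⊆ Iic k) (hv : 2 * vol A + 2 * n = k * (k + 1)) :
    P n ≤ k + per Aᶜ := by
  have hfin : A.Finite := (finite_Iic k).subset hA
  refine ((P_isLeast n).2 ⟨Iic k \ A, (finite_Iic k).subset sdiff_subset, ?_, rfl⟩).trans
    ((vol_mono ((boundary_compl_finite hfin).insert k) ?_).trans
      (vol_insert_le (boundary_compl_finite hfin) k))
  · have := two_mul_vol_diff hA
    omega
  · rintro z ⟨⟨hzk, hzA⟩, hz⟩
    rw [mem_Iic] at hzk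
    by_cases e : z = k
    · exact Or.inl e
    · refine Or.inr ⟨hzA, fun ⟨⟨w, hw, hwz⟩, hs⟩ => hz ⟨⟨w, ⟨?_, hw⟩, hwz⟩, ?_, hs⟩⟩ <;>
        rw [mem_Iic] <;> omega

/-- Removing from `{0, …, k}` a set `A` gives an upper bound for `Q`. -/
theorem Q_le {n k : ℕ} {A : Set ℕ} (hA : A ⊆ Iic k) (hv : 2 * vol A + 2 * n = k * (k + 1)) :
    Q n ≤ k + 1 + per A := by
  have hfin : A.Finite := (finite_Iic k).subset hA
  refine ((Q_isLeast n).2 ⟨Iic k \ A, (finite_Iic k).subset sdiff_subset, ?_, rfl⟩).trans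
    ((vol_mono ((boundary_finite hfin).insert (k + 1)) ?_).trans
      (vol_insert_le (boundary_finite hfin) (k + 1)))
  · have := two_mul_vol_diff hA
    omega
  · have hmem : ∀ z, z ∈ (Iic k \ A)ᶜ ↔ k < z ∨ z ∈ A := fun z => by
      simp only [mem_compl_iff, mem_sdiff, mem_Iic, not_and, not_not]
      exact ⟨fun h => (lt_or_ge k z).imp_right h, fun h hz => h.resolve_left (not_lt.mpr hz)⟩
    rintro z ⟨hzA, hz⟩
    rw [hmem] at hzA
    by_cases e : z = k + 1
    · exact Or.inl e
    · right
      rcases hzA with hzk | hzA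
      · exact absurd ⟨⟨z - 1, (hmem _).mpr (Or.inl (by omega)), by omega⟩,
          (hmem _).mpr (Or.inl (by omega))⟩ hz
      · exact ⟨hzA, fun ⟨⟨w, hw, hwz⟩, hs⟩ =>
          hz ⟨⟨w, (hmem w).mpr (Or.inr hw), hwz⟩, (hmem _).mpr (Or.inr hs)⟩⟩

/-- A set with maximum `k` that also contains `k - 1` loses `k` from its boundary when everything
above `k` is added. -/
theorem add_per_compl_le {A : Set ℕ} {k : ℕ} (hk : k + 1 ∈ A) (hA : A ⊆ Iic (k + 1))
    (hk' : k ∈ A) : k + 1 + per (Iic (k + 1) \ A)ᶜ ≤ per A := by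
  have hmem : ∀ z, z ∈ (Iic (k + 1) \ A)ᶜ ↔ k + 1 < z ∨ z ∈ A := fun z => by
    simp only [mem_compl_iff, mem_sdiff, mem_Iic, not_and, not_not]
    exact ⟨fun h => (lt_or_ge (k + 1) z).imp_right h,
      fun h hz => h.resolve_left (not_lt.mpr hz)⟩
  refine add_vol_le (boundary_finite ((finite_Iic _).subset hA)) (max_mem_boundary hk hA) ?_ ?_
  · rintro z ⟨hzA, hz⟩
    rw [hmem] at hzA
    rcases hzA with hzk | hzA
    · refine absurd ⟨⟨z - 1, (hmem _).mpr ?_, by omega⟩, (hmem _).mpr (Or.inl (by omega))⟩ hz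
      rcases Nat.lt_or_ge (k + 1) (z - 1) with h | h
      · exact Or.inl h
      · right
        rwa [show z - 1 = k + 1 by omega]
    · exact ⟨hzA, fun ⟨⟨w, hw, hwz⟩, hs⟩ =>
        hz ⟨⟨w, (hmem w).mpr (Or.inr hw), hwz⟩, (hmem _).mpr (Or.inr hs)⟩⟩
  · rintro ⟨-, hz⟩
    exact hz ⟨⟨k, (hmem _).mpr (Or.inr hk'), rfl⟩, (hmem _).mpr (Or.inl (by omega))⟩

/-- Since `k ∈ A`, the point `k + 1` always lies on the boundary of `Aᶜ`, so `k - 1 ∈ A` is not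
needed here. -/
theorem add_per_le {A : Set ℕ} {k : ℕ} (hk : k ∈ A) (hA : A ⊆ Iic k) :
    k + 1 + per (Iic k \ A) ≤ per Aᶜ := by
  refine add_vol_le (boundary_compl_finite ((finite_Iic _).subset hA)) ⟨?_, ?_⟩ ?_ ?_
  · intro h
    have := mem_Iic.mp (hA h)
    omega
  · rintro ⟨⟨w, hw, e⟩, -⟩
    obtain rfl : w = k := by omega
    exact hw hk
  · rintro z ⟨⟨hzk, hzA⟩, hz⟩
    rw [mem_Iic] at hzk
    have hne : z ≠ k := fun e => hzA (e ▸ hk)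
    refine ⟨hzA, fun ⟨⟨w, hw, hwz⟩, hs⟩ => hz ⟨⟨w, ⟨?_, hw⟩, hwz⟩, ?_, hs⟩⟩ <;>
      rw [mem_Iic] <;> omega
  · rintro ⟨⟨h, -⟩, -⟩
    have := mem_Iic.mp h
    omega

/-- A set whose maximum `k` is isolated has a perimeter that is at least the sum of its two
largest elements. -/
theorem add_le_per {A : Set ℕ} {k l : ℕ} (hA : A.Finite) (hk : k ∈ A) (hmax : A ⊆ Iic k)
    (hl : l ∈ A) (hlk : l < k) (hl' : l + 1 ∉ A) : k + l ≤ per A := by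
  have := add_vol_le (T := {l}) (boundary_finite hA) (max_mem_boundary hk hmax)
    (singleton_subset_iff.mpr ⟨hl, fun h => hl' h.2⟩) (fun h => hlk.ne' h)
  rwa [vol_singleton] at this

/-- Here `f + 1` is the least index whose triangular number reaches `n`, and `g` is the excess.
Minimality makes `f + 1` a lower bound for the maximum of any set of volume at least `n`. -/
theorem exists_triangular (n : ℕ) (hn : n ≠ 0) :
    ∃ f g : ℕ, g ≤ f ∧ 2 * g + 2 * n = (f + 1) * (f + 2) ∧
      ∀ k, 2 * n ≤ k * (k + 1) → f + 1 ≤ k := by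
  classical
  have hex : ∃ k, 2 * n ≤ k * (k + 1) := ⟨n, by nlinarith [Nat.pos_of_ne_zero hn]⟩
  obtain ⟨f, hf⟩ : ∃ f, Nat.find hex = f + 1 := by
    refine Nat.exists_eq_succ_of_ne_zero fun h => ?_
    have := Nat.find_spec hex
    rw [h] at this
    omega
  have h1 : 2 * n ≤ (f + 1) * (f + 2) := by
    have := Nat.find_spec hex
    rwa [hf] at this
  have h2 : f * (f + 1) < 2 * n :=
    not_le.mp (Nat.find_min hex (show f < Nat.find hex by omega))
  obtain ⟨t, ht⟩ := (Nat.even_mul_succ_self (f + 1)).two_dvd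
  obtain ⟨s, hs⟩ := (Nat.even_mul_succ_self f).two_dvd
  have e : (f + 1) * (f + 2) = f * (f + 1) + 2 * (f + 1) := by ring
  have ht' : (f + 1) * (f + 2) = 2 * t := ht
  have hs' : f * (f + 1) = 2 * s := hs
  refine ⟨f, t - n, by omega, by omega, fun k hk => ?_⟩
  exact hf ▸ Nat.find_min' hex hk

theorem per_singleton_le (n : ℕ) : per {n} ≤ n := by
  have h : vol (boundary {n}) ≤ vol {n} := vol_mono (finite_singleton n) fun _ hz => hz.1
  rwa [vol_singleton] at h

theorem P_zero : P 0 = 0 := by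
  refine Nat.le_zero.mp ((P_isLeast 0).2 ⟨∅, finite_empty, vol_empty, ?_⟩)
  rw [per, show boundary ∅ = ∅ from subset_empty_iff.mp fun _ hz => hz.1, finsum_mem_empty]

theorem Q_zero : Q 0 = 0 := by
  refine Nat.le_zero.mp ((Q_isLeast 0).2 ⟨∅, finite_empty, vol_empty, ?_⟩)
  have h : boundary (∅ᶜ : Set ℕ) ⊆ {0} := by
    rintro z ⟨-, hz⟩
    by_contra h0
    exact hz ⟨⟨z - 1, by simp, Nat.succ_pred_eq_of_ne_zero h0⟩, by simp⟩
  have := vol_mono (finite_singleton 0) h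
  rw [vol_singleton] at this
  exact Nat.le_zero.mp this

theorem Q_le_two_mul {n f g : ℕ} (hg : g ≤ f) (h : 2 * g + 2 * n = (f + 1) * (f + 2)) :
    Q n ≤ 2 * (f + 1) := by
  have := Q_le (n := n) (k := f + 1) (A := {g}) (by simp; omega) (by rw [vol_singleton, h])
  have := per_singleton_le g
  omega

theorem Q_le_add_two (n : ℕ) : Q n ≤ n + 2 := by
  rcases eq_or_ne n 0 with rfl | hn
  · simp [Q_zero]
  obtain ⟨f, g, hg, h, -⟩ := exists_triangular n hn
  have h1 := Q_le_two_mul hg h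
  suffices 2 * f ≤ n by omega
  rcases le_or_gt f 2 with hf | hf
  · interval_cases f <;> omega
  · nlinarith

/-- Delete from `{0, …, f + 1}` a set of volume `g` optimal for `Q`; it costs at most `g + 2 ≤ f +
2`. -/
theorem P_le_two_mul {n f g : ℕ} (hg : g ≤ f) (h : 2 * g + 2 * n = (f + 1) * (f + 2)) :
    P n ≤ 2 * f + 3 := by
  obtain ⟨A, hA, hv, hQ⟩ := (Q_isLeast g).1
  have hAf : A ⊆ Iic (f + 1) := fun z hz => by
    have := le_vol hA hz
    rw [mem_Iic]
    omega
  have := P_le (n := n) hAf (by rw [hv, h])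
  have := Q_le_add_two g
  omega

theorem Q_le_P_add_two {n : ℕ} (hn : n ≠ 0) (ih : ∀ m < n, P m ≤ Q m + 1) :
    Q n ≤ P n + 2 := by
  obtain ⟨f, g, hg, hfg, hf⟩ := exists_triangular n hn
  have hQ := Q_le_two_mul hg hfg
  obtain ⟨A, hA, rfl, hP⟩ := (P_isLeast n).1
  obtain ⟨k, hk, hmax⟩ := exists_max hA hn
  have hfk := hf k (two_mul_vol_le hmax)
  obtain ⟨k, rfl⟩ := Nat.exists_eq_add_of_lt (show 0 < k by omega)
  rw [zero_add] at *
  by_cases hk' : k ∈ A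
  · have hper := add_per_compl_le hk hmax hk'
    have hvol := two_mul_vol_diff hmax
    have hfin : (Iic (k + 1) \ A).Finite := (finite_Iic _).subset sdiff_subset
    set m := vol (Iic (k + 1) \ A) with hm
    have hQm : Q m ≤ per (Iic (k + 1) \ A)ᶜ := (Q_isLeast m).2 ⟨_, hfin, rfl, rfl⟩
    rcases lt_or_ge m (vol A) with hlt | hge
    · have hi := ih m hlt
      obtain ⟨B, hB, hvB, hPB⟩ := (P_isLeast m).1
      by_cases hfit : B ⊆ Iic (k + 1)
      · have := Q_le (n := vol A) hfit (by rw [hvB, hvol])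
        omega
      -- Now `P m ≥ k + 2`, so `Q m ≥ k + 1` and `per A ≥ 2 * (k + 1) ≥ 2 * (f + 1)`.
      · obtain ⟨z, hz, hzk⟩ := not_subset.mp hfit
        rw [mem_Iic] at hzk
        have := le_per hB hz
        omega
    · have := lt_Q (n := m) (m := f + 1) (by omega) fun j hj => hf j (by omega)
      omega
  · have hvk := vol_insert (hA.subset sdiff_subset) (notMem_sdiff_of_mem (mem_singleton (k + 1)))
      (S := A \ {k + 1})
    rw [insert_sdiff_singleton, insert_eq_of_mem hk] at hvk
    have hfin : (A \ {k + 1}).Finite := hA.subset sdiff_subset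
    by_cases h0 : vol (A \ {k + 1}) = 0
    · have := Q_le_add_two (vol A)
      have := le_per hA hk
      omega
    · obtain ⟨l, ⟨hl, hlk⟩, hlmax⟩ := exists_max hfin h0
      have hlk' : l < k + 1 := lt_of_le_of_ne (hmax hl) hlk
      have hne : l ≠ k := fun e => hk' (e ▸ hl)
      have hper := add_le_per hA hk hmax hl hlk' fun h => by
        have := mem_Iic.mp (hlmax ⟨h, fun e => hne (by simpa using e)⟩)
        omega
      have hvl := two_mul_vol_le hlmax
      -- Otherwise `k + l` is so small that `k + 1 + l * (l + 1) / 2`, which bounds the volume,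
      -- cannot exceed `f * (f + 1) / 2`.
      by_contra hcon
      obtain ⟨j, rfl⟩ := Nat.exists_eq_add_of_le (show f ≤ k by omega)
      obtain ⟨i, rfl⟩ := Nat.exists_eq_add_of_le (show l + j + 2 ≤ f by omega)
      have hl0 : l ≠ 0 := by
        rintro rfl
        omega
      nlinarith

theorem P_le_Q_add_one {n : ℕ} (hn : n ≠ 0) (ih : ∀ m < n, Q m ≤ P m + 2) :
    P n ≤ Q n + 1 := by
  obtain ⟨f, g, hg, hfg, hf⟩ := exists_triangular n hn
  have hP := P_le_two_mul hg hfg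
  obtain ⟨A, hA, rfl, hQ⟩ := (Q_isLeast n).1
  obtain ⟨k, hk, hmax⟩ := exists_max hA hn
  have hfk := hf k (two_mul_vol_le hmax)
  have hper := add_per_le hk hmax
  have hvol := two_mul_vol_diff hmax
  have hfin : (Iic k \ A).Finite := (finite_Iic _).subset sdiff_subset
  set m := vol (Iic k \ A) with hm
  have hPm : P m ≤ per (Iic k \ A) := (P_isLeast m).2 ⟨_, hfin, rfl, rfl⟩
  rcases lt_or_ge m (vol A) with hlt | hge
  · have hi := ih m hlt
    obtain ⟨B, hB, hvB, hQB⟩ := (Q_isLeast m).1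
    by_cases hfit : B ⊆ Iic k
    · have := P_le (n := vol A) hfit (by rw [hvB, hvol])
      omega
    -- Now `Q m ≥ k + 2`, so `P m ≥ k` and `per Aᶜ ≥ 2 * k + 1 ≥ 2 * f + 3`.
    · obtain ⟨z, hz, hzk⟩ := not_subset.mp hfit
      rw [mem_Iic] at hzk
      have := lt_per_compl hB hz
      omega
  · have := le_P (n := m) (m := f + 1) (by omega) fun j hj => hf j (by omega)
    omega

theorem Q_le_P_add_two_and_P_le_Q_add_one (n : ℕ) : Q n ≤ P n + 2 ∧ P n ≤ Q n + 1 := by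
  induction n using Nat.strong_induction_on with
  | _ n ih =>
    rcases eq_or_ne n 0 with rfl | hn
    · simp [P_zero, Q_zero]
    · exact ⟨Q_le_P_add_two hn fun m hm => (ih m hm).2, P_le_Q_add_one hn fun m hm => (ih m hm).1⟩

end IntegerIsoperimetry

theorem corollary6p7 (n : ℕ) :
    (-1 : ℤ) ≤ (IntegerIsoperimetry.Q n : ℤ) - (IntegerIsoperimetry.P n : ℤ) ∧
      (IntegerIsoperimetry.Q n : ℤ) - (IntegerIsoperimetry.P n : ℤ) ≤ 2 := by
  have := IntegerIsoperimetry.Q_le_P_add_two_and_P_le_Q_add_one n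
  omega
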